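/- For a monoid $M$ let $\mathrm{PSh}(M)$ be the topos of right $M$-sets. A semigroup homomorphism $\phi : M \to N$ between monoids, with $e = \phi(1)$, induces an essential geometric morphism $f : \mathrm{PSh}(M) \to \mathrm{PSh}(N)$, whose inverse image functor $f^*$ sends a right $N$-set $X$ to the set $Xe = \{x \in X : xe = x\}$ on which $m \in M$ acts as $\phi(m)$ (if $\phi$ is a monoid homomorphism, then $e=1$ and $f^*$ is restriction of the action along $\phi$). An object $A$ of a topos $\mathcal{E}$ is locally constant if there is a family of objects $\{U_k\}_{k \in K}$ whose morphisms to the terminal object are jointly epimorphic and such that, for each $k$, there are a set $I$ and an isomorphism $A \times U_k \cong \bigsqcup_{i \in I} U_k$ over $U_k$. A geometric morphism with codomain $\mathcal{E}$ is locally constant étale if, up to an equivalence of its domain, it is the canonical morphism $\mathcal{E}/A \to \mathcal{E}$ for a locally constant object $A$. A subset $S$ of a monoid $N$ is right-factorable if $x \in S$, $y \in N$ and $xy \in S$ imply $y \in S$, and left-factorable if $x \in N$, $y \in S$ and $xy \in S$ imply $x \in S$. Let $N^{\ltimes} = \{u \in N : \exists v \in N,\ uv = 1\}$ be the set of right-invertible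 elements and $N^{\rtimes} = \{v \in N : \exists u \in N,\ uv = 1\}$ the set of left-invertible elements. Theorem. Let $f : \mathrm{PSh}(M) \to \mathrm{PSh}(N)$ be the essential geometric morphism induced by a monoid homomorphism $\phi : M \to N$. Then the following are equivalent: 1. $f$ is locally constant étale; 2. $\phi$ is injective, $\phi(M) \subseteq N$ is both left-factorable and right-factorable, and for any $n \in N$ there are elements $u \in N^{\ltimes}$, $v \in N^{\rtimes}$ such that $nu \in \phi(M)$ and $vn \in \phi(M)$. More generally, let $f$ be the essential geometric morphism induced by a semigroup homomorphism $\phi : M \to N$, and let $e = \phi(1)$. Then $f$ is locally constant étale if and only if the monoid homomorphism $M \to eNe$ obtained by restricting the codomain of $\phi$ to the monoid $eNe$ (with identity $e$) satisfies the conditions in (2), with $eNe$ in place of $N$, and the geometric morphism $\mathrm{PSh}(eNe) \to \mathrm{PSh}(N)$ induced by the inclusion $eNe \subseteq N$ is an equivalence. -/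

import Mathlib

open CategoryTheory CategoryTheory.Limits

universe v₁ v₂ u₁ u₂ u

/-! ### Right actions of a monoid -/

/-- The topos of presheaves on a monoid `M`, regarded as a category with one object `*` whose
endomorphisms are the elements of `M`, with `m ∘ m' = m * m'`. Its objects are the right
`M`-sets. -/
abbrev PSh (M : Type u) [Monoid M] : Type (u + 1) := (SingleObj M)ᵒᵖ ⥤ Type u

namespace PSh

section basics

variable {M : Type u} [Monoid M]

/-- The underlying set of a right `M`-set. -/
abbrev Carrier (X : PSh M) : Type u := X.obj (Opposite.op (SingleObj.star M))

/-- The right action: `X.act x m` is `x · m`. -/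
def act (X : PSh M) (x : X.Carrier) (m : M) : X.Carrier :=
  X.map (Quiver.Hom.op (X := SingleObj.star M) (Y := SingleObj.star M) m) x

theorem act_one (X : PSh M) (x : X.Carrier) : X.act x 1 = x :=
  congr($(X.map_id (Opposite.op (SingleObj.star M))) x)

theorem act_mul (X : PSh M) (x : X.Carrier) (m m' : M) :
    X.act x (m * m') = X.act (X.act x m) m' :=
  congr($(X.map_comp
    (Quiver.Hom.op (X := SingleObj.star M) (Y := SingleObj.star M) m)
    (Quiver.Hom.op (X := SingleObj.star M) (Y := SingleObj.star M) m')) x)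

/-- The function underlying a homomorphism of right `M`-sets. -/
abbrev fn {X Y : PSh M} (f : X ⟶ Y) (x : X.Carrier) : Y.Carrier :=
  f.app (Opposite.op (SingleObj.star M)) x

theorem fn_act {X Y : PSh M} (f : X ⟶ Y) (x : X.Carrier) (m : M) :
    fn f (X.act x m) = Y.act (fn f x) m :=
  congr($(f.naturality
    (Quiver.Hom.op (X := SingleObj.star M) (Y := SingleObj.star M) m)) x)

theorem fn_ext {X Y : PSh M} {f g : X ⟶ Y} (h : ∀ x, fn f x = fn g x) : f = g := by
  refine NatTrans.ext (funext fun c => ?_)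
  refine TypeCat.Hom.ext (TypeCat.Fun.ext (funext fun x => ?_))
  exact h x

/-- The right `M`-set with underlying set `S` and right action `a`. -/
def of (S : Type u) (a : S → M → S) (h1 : ∀ s, a s 1 = s)
    (hmul : ∀ s m m', a s (m * m') = a (a s m) m') : PSh M where
  obj _ := S
  map m := TypeCat.ofHom fun s => a s m.unop
  map_id _ := TypeCat.Hom.ext (TypeCat.Fun.ext (funext fun s => h1 s))
  map_comp f g :=
    TypeCat.Hom.ext (TypeCat.Fun.ext (funext fun s => hmul s f.unop g.unop))

/-- An equivariant function, as a morphism of right `M`-sets. -/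
def homOf {X Y : PSh M} (g : X.Carrier → Y.Carrier)
    (hg : ∀ x m, g (X.act x m) = Y.act (g x) m) : X ⟶ Y where
  app _ := TypeCat.ofHom g
  naturality _ _ m :=
    TypeCat.Hom.ext (TypeCat.Fun.ext (funext fun x => hg x m.unop))

end basics

end PSh

/-! ### Geometric morphisms -/

/-- A geometric morphism `F → E`: an adjunction `f^* ⊣ f_*` whose left adjoint, the inverse image
functor `f^* : E ⥤ F`, preserves finite limits. -/
structure GeometricMorphism (F : Type u₁) [Category.{v₁} F] (E : Type u₂) [Category.{v₂} E] where
  /-- The inverse image functor `f^*`. -/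
  inverseImage : E ⥤ F
  /-- The direct image functor `f_*`. -/
  directImage : F ⥤ E
  /-- The adjunction `f^* ⊣ f_*`. -/
  adjunction : inverseImage ⊣ directImage
  /-- The inverse image functor preserves finite limits. -/
  preservesFiniteLimits : PreservesFiniteLimits inverseImage

/-- An essential geometric morphism: the inverse image functor has a further left adjoint `f_!`. -/
structure EssentialGeometricMorphism (F : Type u₁) [Category.{v₁} F]
    (E : Type u₂) [Category.{v₂} E] extends GeometricMorphism F E where
  /-- The extra left adjoint `f_!`. -/
  extraLeftAdjoint : F ⥤ E
  /-- The adjunction `f_! ⊣ f^*`. -/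
  extraAdjunction : extraLeftAdjoint ⊣ inverseImage

/-- A geometric morphism is an equivalence of toposes when its inverse image functor is an
equivalence of categories. -/
def GeometricMorphism.IsEquivalence {F : Type u₁} [Category.{v₁} F] {E : Type u₂}
    [Category.{v₂} E] (f : GeometricMorphism F E) : Prop :=
  f.inverseImage.IsEquivalence

/-! ### Locally constant objects and locally constant étale geometric morphisms -/

section locallyConstant

variable {E : Type (u + 1)} [LargeCategory E] [HasFiniteProducts E] [HasCoproducts.{u} E]

/-- `A` is trivialized by `U`: there are a set `I` and an isomorphism `A × U ≅ ∐_{i ∈ I} U` over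
`U`, for the projection `A × U ⟶ U` and the codiagonal `∐_{i ∈ I} U ⟶ U`. -/
def IsTrivializedBy (A U : E) : Prop :=
  ∃ (I : Type u) (ψ : A ⨯ U ≅ ∐ fun _ : I => U),
    ψ.hom ≫ Sigma.desc (fun _ : I => 𝟙 U) = prod.snd

/-- The morphisms from the members of the family `U` to the terminal object are jointly
epimorphic. -/
def JointlyCoversTerminal {K : Type u} (U : K → E) : Prop :=
  ∀ ⦃X : E⦄ (g h : ⊤_ E ⟶ X),
    (∀ k, terminal.from (U k) ≫ g = terminal.from (U k) ≫ h) → g = h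

/-- `A` is locally constant: it is trivialized by each member of some family of objects that jointly
covers the terminal object. -/
def IsLocallyConstantObject (A : E) : Prop :=
  ∃ (K : Type u) (U : K → E), JointlyCoversTerminal U ∧ ∀ k, IsTrivializedBy A (U k)

/-- `f : F → E` is locally constant étale: up to an equivalence `F ≌ E/A`, it is the canonical
geometric morphism `E/A → E` for a locally constant object `A`. The canonical geometric
morphism has the inverse image functor `Over.star A : X ↦ (A ⨯ X ⟶ A)`, and two geometric morphisms
are isomorphic precisely when their inverse image functors are. -/
def GeometricMorphism.IsLocallyConstantEtale {F : Type u₁} [Category.{v₁} F]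
    (f : GeometricMorphism F E) : Prop :=
  ∃ (A : E) (e : F ≌ Over A), IsLocallyConstantObject A ∧
    Nonempty (f.inverseImage ≅ Over.star A ⋙ e.inverse)

end locallyConstant

/-! ### The essential geometric morphism induced by a semigroup homomorphism -/

namespace PSh

section induced

variable {M N : Type u} [Monoid M] [Monoid N] (φ : M →ₙ* N)

/-- The inverse image functor of the geometric morphism induced by `φ`: with `e = φ 1`, it sends a
right `N`-set `X` to the set `X · e = {x | x · e = x}`, on which `m` acts as `φ m`. When `φ` is a
monoid homomorphism this is restriction along `φ`, see `inducedInverseImageIso`. -/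
def inducedInverseImage : PSh N ⥤ PSh M where
  obj X := PSh.of {x : X.Carrier // X.act x (φ 1) = x}
    (fun x m => ⟨X.act x.1 (φ m), by rw [← X.act_mul, ← map_mul, mul_one]⟩)
    (fun x => Subtype.ext x.2)
    (fun x m m' => Subtype.ext (by simp only [map_mul, X.act_mul]))
  map {X Y} f := PSh.homOf
    (fun x => ⟨fn f x.1, by rw [← fn_act, x.2]⟩)
    (fun x m => Subtype.ext (fn_act f x.1 (φ m)))
  map_id X := rfl
  map_comp f g := rfl

/-- The direct image functor of the geometric morphism induced by `φ`: with `e = φ 1`, it sends a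
right `M`-set `Y` to the set of equivariant maps `N e → Y`, where `m` acts on the left ideal `N e`
by right multiplication by `φ m`. Such a map is given here by its composite `h` with
`n ↦ n e : N → N e`. The action of `N` is `(h · k) n = h (k n)`. -/
def inducedDirectImage : PSh M ⥤ PSh N where
  obj Y := PSh.of {h : N → Y.Carrier // ∀ n m, h (n * φ m) = Y.act (h n) m}
    (fun h k => ⟨fun n => h.1 (k * n), fun n m =>
      (congrArg h.1 (mul_assoc k n (φ m)).symm).trans (h.2 (k * n) m)⟩)
    (fun h => Subtype.ext (funext fun n => congrArg h.1 (one_mul n)))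
    (fun h k k' => Subtype.ext (funext fun n => congrArg h.1 (mul_assoc k k' n)))
  map {Y Z} f := PSh.homOf
    (fun h => ⟨fun n => fn f (h.1 n), fun n m =>
      (congrArg (fn f) (h.2 n m)).trans (fn_act f (h.1 n) m)⟩)
    (fun h k => rfl)
  map_id Y := rfl
  map_comp f g := rfl

/-- The adjunction `f^* ⊣ f_*` for the geometric morphism induced by `φ`. -/
def inducedAdjunction : inducedInverseImage φ ⊣ inducedDirectImage φ :=
  Adjunction.mkOfHomEquiv
    { homEquiv := fun X Y =>
        { toFun := fun g => PSh.homOf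
            (fun x => ⟨fun n => fn g ⟨X.act x (n * φ 1), by
                rw [← X.act_mul, mul_assoc, ← map_mul, mul_one]⟩, fun n m => by
                  refine Eq.trans (congrArg (fn g) (Subtype.ext ?_))
                    (fn_act g ⟨X.act x (n * φ 1), by
                      rw [← X.act_mul, mul_assoc, ← map_mul, mul_one]⟩ m)
                  change X.act x (n * φ m * φ 1) = X.act (X.act x (n * φ 1)) (φ m)
                  rw [← X.act_mul, mul_assoc, mul_assoc, ← map_mul, ← map_mul, one_mul,
                    mul_one]⟩)
            (fun x k => Subtype.ext (funext fun n => congrArg (fn g) (Subtype.ext (by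
              change X.act (X.act x k) (n * φ 1) = X.act x (k * n * φ 1)
              rw [← X.act_mul, mul_assoc]))))
          invFun := fun g => PSh.homOf
            (fun x => (fn g x.1).1 1)
            (fun x m => by
              change (fn g (X.act x.1 (φ m))).1 1 = Y.act ((fn g x.1).1 1) m
              rw [fn_act, ← (fn g x.1).2 1 m]
              change (fn g x.1).1 (φ m * 1) = (fn g x.1).1 (1 * φ m)
              rw [mul_one, one_mul])
          left_inv := fun g => fn_ext fun x => congrArg (fn g) (Subtype.ext (by
            change X.act x.1 (1 * φ 1) = x.1
            rw [one_mul, x.2]))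
          right_inv := fun g => fn_ext fun x => Subtype.ext (funext fun n => by
            change (fn g (X.act x (n * φ 1))).1 1 = (fn g x).1 n
            rw [fn_act]
            change (fn g x).1 (n * φ 1 * 1) = (fn g x).1 n
            rw [mul_one, (fn g x).2, Y.act_one]) }
      homEquiv_naturality_left_symm := fun f g => rfl
      homEquiv_naturality_right := fun f g => rfl }

/-- The generating relation of the tensor product `Y ⊗_M e N`, where `e = φ 1`, on pairs `(y, n)`
standing for `y ⊗ e n`. -/
inductive TensorRel (Y : PSh M) : Y.Carrier × N → Y.Carrier × N → Prop
  | intro (y : Y.Carrier) (m : M) (n : N) : TensorRel Y (Y.act y m, n) (y, φ m * n)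

/-- The extra left adjoint of the geometric morphism induced by `φ`: with `e = φ 1`, it sends a right
`M`-set `Y` to `Y ⊗_M e N`, with `N` acting by right multiplication. -/
def inducedExtraLeftAdjoint : PSh M ⥤ PSh N where
  obj Y := PSh.of (Quot (TensorRel φ Y))
    (fun t k => Quot.map (fun p : Y.Carrier × N => (p.1, p.2 * k))
      (by rintro _ _ ⟨y, m, n⟩; rw [mul_assoc]; exact .intro y m (n * k)) t)
    (by rintro ⟨y, n⟩; exact congrArg (fun a => Quot.mk _ (y, a)) (mul_one n))
    (by rintro ⟨y, n⟩ k k'; exact congrArg (fun a => Quot.mk _ (y, a)) (mul_assoc n k k').symm)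
  map {Y Z} f := PSh.homOf
    (Quot.map (fun p : Y.Carrier × N => (fn f p.1, p.2))
      (by rintro _ _ ⟨y, m, n⟩; rw [fn_act]; exact .intro (fn f y) m n))
    (by rintro ⟨y, n⟩ k; rfl)
  map_id Y := fn_ext (by rintro ⟨y, n⟩; rfl)
  map_comp f g := fn_ext (by rintro ⟨y, n⟩; rfl)

/-- The adjunction `f_! ⊣ f^*` for the geometric morphism induced by `φ`. -/
def inducedExtraAdjunction : inducedExtraLeftAdjoint φ ⊣ inducedInverseImage φ :=
  Adjunction.mkOfHomEquiv
    { homEquiv := fun Y X =>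
        { toFun := fun g => PSh.homOf
            (fun y => ⟨fn g (Quot.mk _ (y, 1)), by
              refine (fn_act g (Quot.mk _ (y, 1)) (φ 1)).symm.trans (congrArg (fn g) ?_)
              change Quot.mk (TensorRel φ Y) (y, 1 * φ 1) = Quot.mk _ (y, 1)
              rw [one_mul, ← mul_one (φ 1), ← Quot.sound (TensorRel.intro y 1 1), Y.act_one]⟩)
            (fun y m => Subtype.ext (by
              change fn g (Quot.mk _ (Y.act y m, 1)) = X.act (fn g (Quot.mk _ (y, 1))) (φ m)
              refine Eq.trans (congrArg (fn g) ?_) (fn_act g (Quot.mk _ (y, 1)) (φ m))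
              change Quot.mk (TensorRel φ Y) (Y.act y m, 1) = Quot.mk _ (y, 1 * φ m)
              rw [Quot.sound (TensorRel.intro (φ := φ) y m 1), one_mul, mul_one]))
          invFun := fun g => PSh.homOf
            (Quot.lift (fun p : Y.Carrier × N => X.act (fn g p.1).1 p.2) (by
              rintro _ _ ⟨y, m, n⟩
              rw [X.act_mul, fn_act]
              rfl))
            (by rintro ⟨y, n⟩ k; exact X.act_mul _ n k)
          left_inv := fun g => fn_ext (by
            rintro ⟨y, n⟩
            change X.act (fn g (Quot.mk _ (y, 1))) n = fn g (Quot.mk _ (y, n))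
            exact (fn_act g (Quot.mk _ (y, 1)) n).symm.trans
              (congrArg (fun a => fn g (Quot.mk _ (y, a))) (one_mul n)))
          right_inv := fun g => fn_ext fun y => Subtype.ext (X.act_one _) }
      homEquiv_naturality_left_symm := fun f g => fn_ext (by rintro ⟨y, n⟩; rfl)
      homEquiv_naturality_right := fun f g => rfl }

/-- The essential geometric morphism `PSh M → PSh N` induced by a semigroup homomorphism
`φ : M → N`. -/
def inducedMorphism : EssentialGeometricMorphism (PSh M) (PSh N) where
  inverseImage := inducedInverseImage φ
  directImage := inducedDirectImage φ
  adjunction := inducedAdjunction φ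
  preservesFiniteLimits :=
    have := (inducedExtraAdjunction φ).rightAdjoint_preservesLimits
    inferInstance
  extraLeftAdjoint := inducedExtraLeftAdjoint φ
  extraAdjunction := inducedExtraAdjunction φ

/-- For a monoid homomorphism, the inverse image functor is restriction of the action along `φ`,
that is, precomposition with the functor of one-object categories given by `φ`. -/
def inducedInverseImageIso (φ : M →* N) :
    inducedInverseImage (φ : M →ₙ* N) ≅
      (Functor.whiskeringLeft _ _ (Type u)).obj (SingleObj.mapHom M N φ).op :=
  NatIso.ofComponents
    (fun X =>
      { hom := PSh.homOf (Y := (SingleObj.mapHom M N φ).op ⋙ X) (fun x => x.1) (fun _ _ => rfl)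
        inv := PSh.homOf (X := (SingleObj.mapHom M N φ).op ⋙ X)
          (fun x => ⟨x, by
            change X.act x (φ 1) = x
            rw [map_one, X.act_one]⟩)
          (fun _ _ => rfl)
        hom_inv_id := rfl
        inv_hom_id := rfl })
    (fun _ => rfl)

end induced

end PSh

/-! ### Conditions on monoid homomorphisms -/

section monoids

variable {N : Type u} [Monoid N]

/-- `S` is right-factorable: `x ∈ S` and `x * y ∈ S` imply `y ∈ S`. -/
def IsRightFactorable (S : Set N) : Prop := ∀ x y : N, x ∈ S → x * y ∈ S → y ∈ S

/-- `S` is left-factorable: `y ∈ S` and `x * y ∈ S` imply `x ∈ S`. -/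
def IsLeftFactorable (S : Set N) : Prop := ∀ x y : N, y ∈ S → x * y ∈ S → x ∈ S

/-- The set of right-invertible elements. -/
def rightInvertibles (N : Type u) [Monoid N] : Set N := {u | ∃ v, u * v = 1}

/-- The set of left-invertible elements. -/
def leftInvertibles (N : Type u) [Monoid N] : Set N := {v | ∃ u, u * v = 1}

/-- The injectivity, factorability and invertibility conditions on a monoid homomorphism. -/
structure IsBifactorableEmbedding {M : Type u} [Monoid M] (φ : M →* N) : Prop where
  injective : Function.Injective φ
  leftFactorable : IsLeftFactorable (Set.range φ)
  rightFactorable : IsRightFactorable (Set.range φ)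
  exists_invertible : ∀ n : N, ∃ u ∈ rightInvertibles N, ∃ v ∈ leftInvertibles N,
    n * u ∈ Set.range φ ∧ v * n ∈ Set.range φ

/-- For an idempotent `e` of a monoid `N`, the set `e N e` is a monoid under the multiplication of
`N`, with identity `e`. -/
instance cornerMonoid {e : N} (he : IsIdempotentElem e) : Monoid he.Corner where
  __ : Semigroup he.Corner := inferInstanceAs <| Semigroup (Subsemigroup.corner e)
  one := ⟨e, (Subsemigroup.mem_corner_iff he).2 ⟨he, he⟩⟩
  one_mul r := Subtype.ext ((Subsemigroup.mem_corner_iff he).1 r.2).1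
  mul_one r := Subtype.ext ((Subsemigroup.mem_corner_iff he).1 r.2).2

/-- The inclusion `e N e ⊆ N`, a semigroup homomorphism. -/
def cornerInclusion {e : N} (he : IsIdempotentElem e) : he.Corner →ₙ* N where
  toFun x := x.1
  map_mul' _ _ := rfl

variable {M : Type u} [Monoid M] (φ : M →ₙ* N)

theorem isIdempotentElem_map_one : IsIdempotentElem (φ 1) := by
  rw [IsIdempotentElem, ← map_mul, mul_one]

/-- The monoid homomorphism part `M → e N e`, `e = φ 1`, of a semigroup homomorphism `φ : M → N`. -/
def monoidHomPart : M →* (isIdempotentElem_map_one φ).Corner where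
  toFun m := ⟨φ m, (Subsemigroup.mem_corner_iff (isIdempotentElem_map_one φ)).2
    ⟨by rw [← map_mul, one_mul], by rw [← map_mul, mul_one]⟩⟩
  map_one' := rfl
  map_mul' m m' := Subtype.ext (map_mul φ m m')

end monoids

/-! A right `N`-set `A` is locally constant exactly when every element of `N` acts on it
bijectively, so the question is when right `M`-sets form the slice over such an `A`, compatibly with
`f^*`. The slice is recovered from one point `a₀`, the image of the canonical generator of `f_!(M) ≅
eN`, where `e = φ 1`. Endomorphisms of that generator over `A` are the elements of `eNe` that fix
`a₀`, so this stabilizer must be a copy of `M`; and every representable of the slice must be a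
retract of the generator, which means that each `a` is carried to `a₀` by some `v = ve` with a right
inverse `w = ew`. These conditions make up `IsEtalePoint`. They also suffice, because the functor
taking the part fixed by `e` of the fiber over `a₀` is then an equivalence, and composed with
pullback to `A` it is `f^*`.

It remains to express the existence of a point in terms of monoids. Given one, `φ(M)` is the
stabilizer of `a₀` in `eNe`: left-factorability comes from injectivity of the action,
right-factorability is formal, and the invertible elements come from the retractions. Conversely,
`A` is the quotient of `N` by the syntactic right congruence of `φ(M)`, pulled back along `n ↦ ene`,
with `a₀` the class of `1`; `IsBifactorableEmbedding.syntacticRel_of_mul_mem` is the key to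
bijectivity. The retraction `vw = 1` through `e` alone is equivalent to the Morita condition on `eNe
⊆ N`. -/

namespace PSh

/-! ### Elements of right `M`-sets and the description of locally constant objects -/

section elements

variable {M : Type u} [Monoid M]

theorem fn_id {X : PSh M} (x : X.Carrier) : fn (𝟙 X) x = x := rfl

theorem fn_comp {X Y Z : PSh M} (f : X ⟶ Y) (g : Y ⟶ Z) (x : X.Carrier) :
    fn (f ≫ g) x = fn g (fn f x) := rfl

theorem fn_hom_inv {X Y : PSh M} (i : X ≅ Y) (x : X.Carrier) : fn i.inv (fn i.hom x) = x := by
  rw [← fn_comp, i.hom_inv_id, fn_id]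

theorem fn_inv_hom {X Y : PSh M} (i : X ≅ Y) (y : Y.Carrier) : fn i.hom (fn i.inv y) = y := by
  rw [← fn_comp, i.inv_hom_id, fn_id]

/-- The isomorphism given by an equivariant bijection. -/
def isoOf {X Y : PSh M} (g : X.Carrier ≃ Y.Carrier)
    (hg : ∀ x m, g (X.act x m) = Y.act (g x) m) : X ≅ Y where
  hom := homOf g hg
  inv := homOf g.symm fun y m => by
    rw [Equiv.symm_apply_eq, hg, Equiv.apply_symm_apply]
  hom_inv_id := fn_ext g.symm_apply_apply
  inv_hom_id := fn_ext g.apply_symm_apply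

variable (M) in
/-- The monoid `M`, acting on itself from the right. -/
def regular : PSh M := of M (fun x m => x * m) mul_one fun x m m' => (mul_assoc x m m').symm

/-- The element `1` of the regular `M`-set. -/
def unit : (regular M).Carrier := (1 : M)

/-- An element of `M`, as an element of the regular `M`-set. -/
def toRegular (m : M) : (regular M).Carrier := m

/-- An element of the regular `M`-set, as an element of `M`. -/
def ofRegular (x : (regular M).Carrier) : M := x

theorem toRegular_ofRegular (x : (regular M).Carrier) : toRegular (ofRegular x) = x := rfl

theorem act_unit (m : M) : (regular M).act unit m = toRegular m := one_mul m

/-- The homomorphism from the regular `M`-set that sends `1` to `x`. -/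
def elt {X : PSh M} (x : X.Carrier) : regular M ⟶ X :=
  homOf (X := regular M) (fun m : M => X.act x m) fun m m' => X.act_mul x m m'

theorem fn_elt {X : PSh M} (x : X.Carrier) (m : (regular M).Carrier) :
    fn (elt x) m = X.act x (ofRegular m) := rfl

theorem fn_elt_unit {X : PSh M} (x : X.Carrier) : fn (elt x) unit = x := X.act_one x

theorem eq_elt {X : PSh M} (f : regular M ⟶ X) : f = elt (fn f unit) :=
  fn_ext fun x => by
    rw [fn_elt, ← fn_act, act_unit, toRegular_ofRegular]

theorem regular_hom_ext {X : PSh M} {f g : regular M ⟶ X} (h : fn f unit = fn g unit) :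
    f = g := by
  rw [eq_elt f, eq_elt g, h]

theorem elt_comp {X Y : PSh M} (x : X.Carrier) (f : X ⟶ Y) : elt x ≫ f = elt (fn f x) :=
  regular_hom_ext (by rw [fn_comp, fn_elt_unit, fn_elt_unit])

theorem prod_ext {X Y : PSh M} {z z' : (X ⨯ Y).Carrier}
    (h1 : fn (prod.fst : X ⨯ Y ⟶ X) z = fn (prod.fst : X ⨯ Y ⟶ X) z')
    (h2 : fn (prod.snd : X ⨯ Y ⟶ Y) z = fn (prod.snd : X ⨯ Y ⟶ Y) z') : z = z' := by
  have : elt z = elt z' := Limits.prod.hom_ext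
    (by rw [elt_comp, elt_comp, h1]) (by rw [elt_comp, elt_comp, h2])
  rw [← fn_elt_unit z, this, fn_elt_unit]

/-- The element of a product with given components. -/
noncomputable def pair {X Y : PSh M} (x : X.Carrier) (y : Y.Carrier) : (X ⨯ Y).Carrier :=
  fn (prod.lift (elt x) (elt y)) unit

theorem fst_pair {X Y : PSh M} (x : X.Carrier) (y : Y.Carrier) :
    fn (prod.fst : X ⨯ Y ⟶ X) (pair x y) = x := by
  rw [pair, ← fn_comp, prod.lift_fst, fn_elt_unit]

theorem snd_pair {X Y : PSh M} (x : X.Carrier) (y : Y.Carrier) :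
    fn (prod.snd : X ⨯ Y ⟶ Y) (pair x y) = y := by
  rw [pair, ← fn_comp, prod.lift_snd, fn_elt_unit]

theorem pair_act {X Y : PSh M} (x : X.Carrier) (y : Y.Carrier) (m : M) :
    (X ⨯ Y).act (pair x y) m = pair (X.act x m) (Y.act y m) :=
  prod_ext (by rw [fn_act, fst_pair, fst_pair]) (by rw [fn_act, snd_pair, snd_pair])

theorem pair_fst_snd {X Y : PSh M} (z : (X ⨯ Y).Carrier) :
    pair (fn (prod.fst : X ⨯ Y ⟶ X) z) (fn (prod.snd : X ⨯ Y ⟶ Y) z) = z :=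
  prod_ext (by rw [fst_pair]) (by rw [snd_pair])

/-- The product of the set `I`, with trivial action, and `U`. -/
def copies (I : Type u) (U : PSh M) : PSh M :=
  of (I × U.Carrier) (fun z m => (z.1, U.act z.2 m)) (fun z => Prod.ext rfl (U.act_one z.2))
    fun z m m' => Prod.ext rfl (U.act_mul z.2 m m')

/-- The element with the given components. -/
def copy {I : Type u} {U : PSh M} (i : I) (x : U.Carrier) : (copies I U).Carrier := (i, x)

/-- A coproduct of copies of `U` consists of pairs. -/
noncomputable def sigmaIso (I : Type u) (U : PSh M) : (∐ fun _ : I => U) ≅ copies I U where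
  hom := Sigma.desc fun i => homOf (Y := copies I U) (fun x => (i, x)) fun _ _ => rfl
  inv := homOf (X := copies I U) (fun z => fn (Sigma.ι (fun _ : I => U) z.1) z.2)
    fun z m => fn_act (Sigma.ι (fun _ : I => U) z.1) z.2 m
  hom_inv_id := Sigma.hom_ext _ _ fun i => by
    rw [Sigma.ι_desc_assoc, Category.comp_id]
    rfl
  inv_hom_id := fn_ext fun z => by
    have h := Sigma.ι_desc (fun i => homOf (Y := copies I U) (fun x => (i, x)) fun _ _ => rfl) z.1
    exact congrArg (fun k => fn k z.2) h

theorem sigmaIso_hom_snd (I : Type u) (U : PSh M) :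
    (sigmaIso I U).hom ≫ homOf (X := copies I U) (Y := U) Prod.snd (fun _ _ => rfl) =
      Sigma.desc fun _ : I => 𝟙 U :=
  Sigma.hom_ext _ _ fun i => by
    rw [sigmaIso, Sigma.ι_desc_assoc, Sigma.ι_desc]
    rfl

/-- Read over each point `x` of `U`, an isomorphism over `U` is a bijection `A ≃ I`; equivariance
appears as compatibility with the trivial action on `I`. -/
theorem isTrivializedBy_iff (A U : PSh M) :
    IsTrivializedBy A U ↔ ∃ (I : Type u) (χ : U.Carrier → A.Carrier ≃ I),
      ∀ (a : A.Carrier) (x : U.Carrier) (m : M), χ (U.act x m) (A.act a m) = χ x a := by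
  constructor
  · rintro ⟨I, ψ, hψ⟩
    let χ := ψ ≪≫ sigmaIso I U
    have hχ : ∀ z, (fn χ.hom z : I × U.Carrier).2 = fn (prod.snd : A ⨯ U ⟶ U) z := fun z => by
      rw [← hψ, ← sigmaIso_hom_snd]
      rfl
    have hχ' : ∀ i x, fn (prod.snd : A ⨯ U ⟶ U)
        (fn χ.inv (copy i x)) = x := fun i x => by
      rw [← hχ, fn_inv_hom]
      rfl
    refine ⟨I, fun x =>
      { toFun := fun a => (fn χ.hom (pair a x) : I × U.Carrier).1
        invFun := fun i => fn (prod.fst : A ⨯ U ⟶ A)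
          (fn χ.inv (copy i x))
        left_inv := fun a => ?_
        right_inv := fun i => ?_ }, fun a x m => ?_⟩
    · have : copy (fn χ.hom (pair a x) : I × U.Carrier).1 x =
          fn χ.hom (pair a x) := Prod.ext rfl ((snd_pair a x).symm.trans (hχ _).symm)
      dsimp only
      rw [this, fn_hom_inv, fst_pair]
    · have := pair_fst_snd (fn χ.inv (copy i x))
      rw [hχ'] at this
      dsimp only
      rw [this, fn_inv_hom]
      rfl
    · change (fn χ.hom (pair (A.act a m) (U.act x m)) : I × U.Carrier).1 = _
      rw [← pair_act, fn_act]
      rfl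
  · rintro ⟨I, χ, hχ⟩
    refine ⟨I, isoOf (X := A ⨯ U) (Y := copies I U)
      { toFun := fun z => (χ (fn (prod.snd : A ⨯ U ⟶ U) z) (fn (prod.fst : A ⨯ U ⟶ A) z),
          fn (prod.snd : A ⨯ U ⟶ U) z)
        invFun := fun w => pair ((χ w.2).symm w.1) w.2
        left_inv := fun z => ?_
        right_inv := fun w => ?_ } (fun z m => ?_) ≪≫ (sigmaIso I U).symm, ?_⟩
    · dsimp only
      rw [Equiv.symm_apply_apply, pair_fst_snd]
    · dsimp only
      rw [fst_pair, snd_pair, Equiv.apply_symm_apply]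
      rfl
    · refine Prod.ext ?_ (fn_act _ z m)
      change χ (fn (prod.snd : A ⨯ U ⟶ U) ((A ⨯ U).act z m))
        (fn (prod.fst : A ⨯ U ⟶ A) ((A ⨯ U).act z m)) = _
      rw [fn_act, fn_act, hχ]
      rfl
    · rw [← sigmaIso_hom_snd, Iso.trans_hom, Iso.symm_hom, Category.assoc, Iso.inv_hom_id_assoc]
      rfl

/-- The terminal object is a single point, so one element suffices to cover it. If all `U k` are
empty, the two points of a two-element set with trivial action are not separated. -/
theorem jointlyCoversTerminal_iff {K : Type u} (U : K → PSh M) :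
    JointlyCoversTerminal U ↔ ∃ k, Nonempty (U k).Carrier := by
  constructor
  · intro h
    by_contra hU
    have hU : ∀ k, (U k).Carrier → False := fun k x => hU ⟨k, ⟨x⟩⟩
    let B : PSh M := of (ULift.{u} Bool) (fun b _ => b) (fun _ => rfl) fun _ _ _ => rfl
    have := h (X := B) (homOf (fun _ => ⟨true⟩) fun _ _ => rfl)
      (homOf (fun _ => ⟨false⟩) fun _ _ => rfl) fun k => fn_ext fun x => (hU k x).elim
    have := congrArg (fun g => fn g (fn (terminal.from (regular M)) unit)) this
    exact Bool.noConfusion (congrArg ULift.down (show (⟨true⟩ : ULift.{u} Bool) = ⟨false⟩ from this))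
  · rintro ⟨k, ⟨x⟩⟩ X g h H
    refine fn_ext fun t => ?_
    have ht : t = fn (terminal.from (U k)) x := by
      rw [← fn_elt_unit t, ← fn_elt_unit (fn (terminal.from (U k)) x)]
      exact congrArg (fun g => fn g unit) (terminal.hom_ext _ _)
    rw [ht, ← fn_comp, H k, fn_comp]

/-- Trivializations at `x` and `x · m` differ by the action of `m`, which is therefore bijective.
Conversely, the regular `M`-set trivializes `A`: over `m`, the chart is the inverse of the action of
`m`. -/
theorem isLocallyConstantObject_iff (A : PSh M) :
    IsLocallyConstantObject A ↔ ∀ m, Function.Bijective fun a => A.act a m := by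
  constructor
  · rintro ⟨K, U, hU, hA⟩ m
    obtain ⟨k, ⟨x⟩⟩ := (jointlyCoversTerminal_iff U).1 hU
    obtain ⟨I, χ, hχ⟩ := (isTrivializedBy_iff A (U k)).1 (hA k)
    have : (fun a => A.act a m) = (χ ((U k).act x m)).symm ∘ χ x := funext fun a => by
      rw [Function.comp_apply, Equiv.eq_symm_apply, hχ]
    rw [this]
    exact (χ x |>.trans (χ ((U k).act x m)).symm).bijective
  · intro h
    refine ⟨PUnit, fun _ => regular M, (jointlyCoversTerminal_iff _).2 ⟨⟨⟩, ⟨unit⟩⟩, fun _ =>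
      (isTrivializedBy_iff _ _).2 ⟨A.Carrier, fun m => (Equiv.ofBijective _ (h m)).symm,
        fun a (x : M) m => ?_⟩⟩
    rw [Equiv.symm_apply_eq]
    change A.act a m = A.act ((Equiv.ofBijective _ (h x)).symm a) (x * m)
    rw [A.act_mul]
    congr 1
    exact (Equiv.apply_symm_apply (Equiv.ofBijective _ (h x)) a).symm

end elements

end PSh

namespace PSh

/-! ### From a locally constant étale morphism to a point of `A` -/

section etale

variable {M N : Type u} [Monoid M] [Monoid N] (φ : M →ₙ* N)

/-- The conditions on a point `a₀` of a right `N`-set `A` under which the fiber over `a₀` exhibits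
the topos of right `M`-sets as the slice over the locally constant object `A`. -/
structure IsEtalePoint (A : PSh N) (a₀ : A.Carrier) : Prop where
  bijective : ∀ n, Function.Bijective fun a => A.act a n
  injective : Function.Injective φ
  act_eq : ∀ m, A.act a₀ (φ m) = a₀
  exists_eq : ∀ n, φ 1 * n = n → n * φ 1 = n → A.act a₀ n = a₀ → ∃ m, φ m = n
  exists_retraction : ∀ a, ∃ v w : N, v * w = 1 ∧ v * φ 1 = v ∧ φ 1 * w = w ∧ A.act a v = a₀

variable {φ}

/-- The element `y ⊗ n` of the tensor product `Y ⊗_M e N`. -/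
def tmul {Y : PSh M} (y : Y.Carrier) (n : N) : ((inducedExtraLeftAdjoint φ).obj Y).Carrier :=
  Quot.mk (TensorRel φ Y) (y, n)

theorem act_tmul {Y : PSh M} (y : Y.Carrier) (n k : N) :
    PSh.act _ (tmul (φ := φ) y n) k = tmul y (n * k) := rfl

theorem map_tmul {Y Z : PSh M} (f : Y ⟶ Z) (y : Y.Carrier) (n : N) :
    fn ((inducedExtraLeftAdjoint φ).map f) (tmul y n) = tmul (fn f y) n := rfl

theorem tmul_act {Y : PSh M} (y : Y.Carrier) (m : M) (n : N) :
    tmul (φ := φ) (Y.act y m) n = tmul y (φ m * n) := Quot.sound (.intro y m n)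

theorem exists_tmul {Y : PSh M} (t : ((inducedExtraLeftAdjoint φ).obj Y).Carrier) :
    ∃ (y : Y.Carrier) (n : N), tmul y n = t := by
  obtain ⟨y, n⟩ := t
  exact ⟨y, n, rfl⟩

/-- The map `y ⊗ n ↦ φ y * n` respects the tensor relation, so it separates the elements as in `M
⊗_M eN ≅ eN`. -/
theorem tmul_unit_injective {n n' : N}
    (h : tmul (φ := φ) (Y := regular M) unit n = tmul unit n') : φ 1 * n = φ 1 * n' := by
  have := congrArg (Quot.lift (fun p : (regular M).Carrier × N => φ p.1 * p.2) (by
    rintro _ _ ⟨(y : M), m, n⟩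
    change φ (y * m) * n = φ y * (φ m * n)
    rw [map_mul, mul_assoc])) h
  exact this

theorem IsEtalePoint.act_retraction {A : PSh N} {a₀ a : A.Carrier}
    {v w : N} (h : v * w = 1) (ha : A.act a v = a₀) : A.act a₀ w = a := by
  rw [← ha, ← A.act_mul, h, A.act_one]

theorem exists_isEtalePoint_of_isLocallyConstantEtale
    (h : (inducedMorphism φ).IsLocallyConstantEtale) : ∃ A a₀, IsEtalePoint φ A a₀ := by
  obtain ⟨A, E, hA, ⟨i⟩⟩ := h
  -- Uniqueness of left adjoints: the inverse image is pullback to `A` followed by `E.inverse`, so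
  -- `f_!` is `E.functor` followed by the forgetful functor.
  let j : inducedExtraLeftAdjoint φ ≅ E.functor ⋙ Over.forget A :=
    (conjugateIsoEquiv (inducedExtraAdjunction φ)
      (E.toAdjunction.comp (Over.forgetAdjStar A))).symm i |>.symm
  let F := E.functor
  let τ : ∀ Y, (inducedExtraLeftAdjoint φ).obj Y ≅ (F.obj Y).left := fun Y => j.app Y
  have hτ : ∀ {Y Z : PSh M} (f : Y ⟶ Z),
      (inducedExtraLeftAdjoint φ).map f ≫ (τ Z).hom = (τ Y).hom ≫ (F.map f).left :=
    fun f => j.hom.naturality f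
  have hnat : ∀ {Y Z : PSh M} (f : Y ⟶ Z) (y : Y.Carrier) (n : N),
      fn (F.map f).left (fn (τ Y).hom (tmul y n)) = fn (τ Z).hom (tmul (fn f y) n) :=
    fun {Y Z} f y n => by
      rw [← map_tmul, ← fn_comp, ← fn_comp, hτ]
  let P := F.obj (regular M)
  let p : P.left.Carrier := fn (τ (regular M)).hom (tmul unit 1)
  have hp : ∀ n, P.left.act p n = fn (τ (regular M)).hom (tmul unit n) := fun n => by
    rw [← fn_act, act_tmul, one_mul]
  have hsurj : ∀ x, ∃ n, P.left.act p n = x := fun x => by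
    obtain ⟨y, n, hy⟩ := exists_tmul (fn (τ (regular M)).inv x)
    refine ⟨φ (ofRegular y) * n, ?_⟩
    rw [hp, ← tmul_act, act_unit, toRegular_ofRegular, hy, fn_inv_hom]
  have hinj : ∀ n n', P.left.act p n = P.left.act p n' → φ 1 * n = φ 1 * n' := fun n n' h => by
    rw [hp, hp] at h
    have := congrArg (fn (τ (regular M)).inv) h
    rw [fn_hom_inv, fn_hom_inv] at this
    exact tmul_unit_injective this
  have hinj' : ∀ n n', φ 1 * n = φ 1 * n' → P.left.act p n = P.left.act p n' := fun n n' h => by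
    have hu : (unit : (regular M).Carrier) = PSh.act _ unit 1 := (act_one _ _).symm
    rw [hp, hp, hu, tmul_act, tmul_act, h]
  have hF : ∀ m : M, fn (F.map (elt (toRegular m))).left p = P.left.act p (φ m) := fun m => by
    rw [hnat, fn_elt_unit, hp, ← act_unit, tmul_act, mul_one]
  have hom_ext : ∀ {Z : Over A} (f g : P ⟶ Z), fn f.left p = fn g.left p → f = g :=
    fun f g h => Over.OverMorphism.ext (fn_ext fun x => by
      obtain ⟨n, rfl⟩ := hsurj x
      rw [fn_act, fn_act, h])
  have hover : ∀ {Z W : Over A} (f : Z ⟶ W) (z : Z.left.Carrier),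
      fn W.hom (fn f.left z) = fn Z.hom z := fun f z => by
    rw [← fn_comp, Over.w]
  refine ⟨A, fn P.hom p, (isLocallyConstantObject_iff A).1 hA, fun m m' h => ?_, fun m => ?_,
    fun n hn hn' ha => ?_, fun a => ?_⟩
  · have : F.map (elt (toRegular m)) = F.map (elt (toRegular m')) :=
      hom_ext _ _ (by rw [hF, hF, h])
    have := congrArg (fun k => fn k unit) (F.map_injective this)
    rwa [fn_elt_unit, fn_elt_unit] at this
  · rw [← fn_act, ← hF, hover]
  -- Left multiplication by `n` on `eN` is well defined as `n * e = n`, and lies over `A` as `n`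
  -- fixes `a₀`. Fullness makes it come from an element of `M`.
  · choose c hc using hsurj
    have hc' : ∀ k k', P.left.act p k = P.left.act p k' →
        P.left.act p (n * k) = P.left.act p (n * k') := fun k k' h => by
      rw [← hn', mul_assoc, mul_assoc, hinj _ _ h]
    let g : P ⟶ P := Over.homMk (homOf (fun x => P.left.act p (n * c x)) fun x k => by
      rw [← P.left.act_mul, mul_assoc]
      apply hc'
      rw [hc, P.left.act_mul, hc]) (fn_ext fun x => by
        rw [fn_comp]
        change fn P.hom (P.left.act p (n * c x)) = _
        rw [fn_act, A.act_mul, ha, ← fn_act, hc])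
    obtain ⟨l, hl⟩ := F.map_surjective g
    refine ⟨ofRegular (fn l unit), ?_⟩
    have h1 : P.left.act p (φ (ofRegular (fn l unit))) = P.left.act p n := by
      rw [← hF, toRegular_ofRegular, ← eq_elt, hl]
      change P.left.act p (n * c p) = _
      have := hc' (c p) 1 (by rw [hc, P.left.act_one])
      rwa [mul_one] at this
    have := hinj _ _ h1
    rwa [hn, ← map_mul, one_mul] at this
  -- `Q` is the representable at `a`. Since the counit at `Q` is invertible, the generator `1` is
  -- hit by some map from `P`; the image of `p` under it is `v`, and `1` is the image of `p · n`, so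
  -- `v * n = 1`.
  · let Q : Over A := Over.mk (elt a)
    let Y := E.inverse.obj Q
    let k : F.obj Y ⟶ Q := E.counit.app Q
    let l : Q ⟶ F.obj Y := E.counitInv.app Q
    have hlk : l ≫ k = 𝟙 Q := E.counitIso.inv_hom_id_app Q
    obtain ⟨y, n, hy⟩ := exists_tmul (fn (τ Y).inv (fn l.left unit))
    have hy' : fn (τ Y).hom (tmul y n) = fn l.left unit := by
      rw [hy, fn_inv_hom]
    let g : P ⟶ Q := F.map (elt y) ≫ k
    have hg : fn g.left (P.left.act p n) = unit := by
      change fn k.left (fn (F.map (elt y)).left _) = _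
      rw [hp, hnat, fn_elt_unit, hy', ← fn_comp, ← Over.comp_left, hlk]
      rfl
    have hvw : ∀ k, ofRegular (fn g.left (P.left.act p k)) = ofRegular (fn g.left p) * k :=
      fun k => congrArg ofRegular (fn_act g.left p k)
    refine ⟨ofRegular (fn g.left p), φ 1 * n, ?_, ?_, ?_, ?_⟩
    · rw [← hvw, ← hinj' n (φ 1 * n) (by rw [← mul_assoc, ← map_mul, one_mul])]
      exact hg
    · rw [← hvw, ← hinj' 1 (φ 1) (by rw [← map_mul, one_mul, mul_one]), P.left.act_one]
    · rw [← mul_assoc, ← map_mul, one_mul]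
    · exact hover g p

end etale

end PSh

namespace PSh

/-! ### The fiber over an étale point is an equivalence -/

section fiber

variable {M N : Type u} [Monoid M] [Monoid N] {φ : M →ₙ* N} {A : PSh N}

/-- The functor that sends `p : X ⟶ A` to the set of `x : X` such that `x · φ 1 = x` and
`p x = a₀`, on which `m` acts as `φ m`. -/
def fiberFunctor (a₀ : A.Carrier) (h : ∀ m, A.act a₀ (φ m) = a₀) : Over A ⥤ PSh M where
  obj X := of {x : X.left.Carrier // X.left.act x (φ 1) = x ∧ fn X.hom x = a₀}
    (fun x m => ⟨X.left.act x.1 (φ m), by rw [← act_mul, ← map_mul, mul_one], by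
      rw [fn_act, x.2.2, h]⟩)
    (fun x => Subtype.ext x.2.1)
    (fun x m m' => Subtype.ext (by simp only [map_mul, act_mul]))
  map {X Y} f := homOf
    (fun x => ⟨fn f.left x.1, by rw [← fn_act, x.2.1], by
      rw [← fn_comp, Over.w, x.2.2]⟩)
    (fun x m => Subtype.ext (fn_act f.left x.1 (φ m)))
  map_id X := rfl
  map_comp f g := rfl

variable {a₀ : A.Carrier} {h : ∀ m, A.act a₀ (φ m) = a₀}

/-- An element of the fiber over `a₀`. -/
def fiberMk {X : Over A} (x : X.left.Carrier) (hx : X.left.act x (φ 1) = x)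
    (hx' : fn X.hom x = a₀) : ((fiberFunctor a₀ h).obj X).Carrier := ⟨x, hx, hx'⟩

/-- The element of `X` underlying an element of the fiber over `a₀`. -/
def fiberVal {X : Over A} (x : ((fiberFunctor a₀ h).obj X).Carrier) : X.left.Carrier := x.1

theorem fiberVal_mk {X : Over A} (x : X.left.Carrier) (hx : X.left.act x (φ 1) = x)
    (hx' : fn X.hom x = a₀) : fiberVal (fiberMk (h := h) x hx hx') = x := rfl

theorem fiberVal_act_one {X : Over A} (x : ((fiberFunctor a₀ h).obj X).Carrier) :
    X.left.act (fiberVal x) (φ 1) = fiberVal x := x.2.1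

theorem fn_fiberVal {X : Over A} (x : ((fiberFunctor a₀ h).obj X).Carrier) :
    fn X.hom (fiberVal x) = a₀ := x.2.2

theorem fiberVal_act {X : Over A} (x : ((fiberFunctor a₀ h).obj X).Carrier) (m : M) :
    fiberVal (((fiberFunctor a₀ h).obj X).act x m) = X.left.act (fiberVal x) (φ m) := rfl

theorem fiberVal_map {X Y : Over A} (f : X ⟶ Y) (x : ((fiberFunctor a₀ h).obj X).Carrier) :
    fiberVal (fn ((fiberFunctor a₀ h).map f) x) = fn f.left (fiberVal x) := rfl

theorem fiber_ext {X : Over A} {x y : ((fiberFunctor a₀ h).obj X).Carrier}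
    (hxy : fiberVal x = fiberVal y) : x = y := Subtype.ext hxy

/-- Every `x` is `(x · v) · w` with `x · v` in the fiber, so a morphism is determined by its values
there. -/
theorem IsEtalePoint.faithful_fiberFunctor (H : IsEtalePoint φ A a₀) :
    (fiberFunctor a₀ H.act_eq).Faithful where
  map_injective {X Y f g} hfg := Over.OverMorphism.ext (fn_ext fun x => by
    obtain ⟨v, w, hvw, hv, -, ha⟩ := H.exists_retraction (fn X.hom x)
    have h1 : X.left.act (X.left.act x v) (φ 1) = X.left.act x v := by rw [← act_mul, hv]
    have h2 : fn X.hom (X.left.act x v) = a₀ := by rw [fn_act, ha]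
    have := congrArg (fun k => fiberVal (fn k (fiberMk (h := H.act_eq) _ h1 h2))) hfg
    rw [fiberVal_map, fiberVal_map, fiberVal_mk] at this
    rw [← X.left.act_one x, ← hvw, act_mul, fn_act, this, ← fn_act])

/-- A map `k` on fibers extends by `x ↦ k (x · v) · w`, with `v` and `w` chosen for the image of `x`
in `A`. -/
theorem IsEtalePoint.full_fiberFunctor (H : IsEtalePoint φ A a₀) :
    (fiberFunctor a₀ H.act_eq).Full where
  map_surjective {X Y} k := by
    choose v w hvw hv hw ha using H.exists_retraction
    have haw : ∀ a, A.act a₀ (w a) = a := fun a => act_retraction (hvw a) (ha a)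
    let c : X.left.Carrier → ((fiberFunctor a₀ H.act_eq).obj X).Carrier := fun x =>
      fiberMk (X.left.act x (v (fn X.hom x))) (by rw [← act_mul, hv]) (by rw [fn_act, ha])
    have hc : ∀ x, fiberVal (c x) = X.left.act x (v (fn X.hom x)) := fun x => rfl
    let g : X.left ⟶ Y.left := homOf
      (fun x => Y.left.act (fiberVal (fn k (c x))) (w (fn X.hom x))) fun x n => by
        -- This element moves `a₀` to the base point of `x`, then to that of `x · n`, then back to
        -- `a₀`, so it comes from `M`.
        obtain ⟨m, hm⟩ := H.exists_eq (w (fn X.hom x) * n * v (fn X.hom (X.left.act x n)))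
          (by rw [← mul_assoc, ← mul_assoc, hw]) (by rw [mul_assoc, hv])
          (by rw [act_mul, act_mul, haw, ← fn_act, ha])
        have : c (X.left.act x n) = PSh.act _ (c x) m := fiber_ext (by
          rw [fiberVal_act, hm, hc, hc, ← act_mul, ← act_mul, ← mul_assoc, ← mul_assoc, hvw,
            one_mul])
        rw [this, fn_act, fiberVal_act, hm, ← act_mul, ← act_mul, mul_assoc, hvw, mul_one]
    have hg : ∀ x, fn g x = Y.left.act (fiberVal (fn k (c x))) (w (fn X.hom x)) := fun x => rfl
    refine ⟨Over.homMk g (fn_ext fun x => ?_), fn_ext fun x => fiber_ext ?_⟩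
    · rw [fn_comp, hg, fn_act, fn_fiberVal, haw]
    · rw [fiberVal_map]
      change fn g _ = _
      rw [hg, fn_fiberVal]
      -- The retraction chosen at `a₀` need not be trivial, but `φ 1 * v a₀` fixes `a₀` and so
      -- belongs to `M`, where `k` is equivariant.
      obtain ⟨m, hm⟩ := H.exists_eq (φ 1 * v a₀)
          (by rw [← mul_assoc, ← map_mul, mul_one]) (by rw [mul_assoc, hv])
          (by rw [act_mul, H.act_eq, ha])
      have : c (fiberVal x) = PSh.act _ x m := fiber_ext (by
        rw [fiberVal_act, hm, hc, fn_fiberVal, act_mul, fiberVal_act_one])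
      rw [this, fn_act, fiberVal_act, hm, ← act_mul, mul_assoc, hvw, mul_one, fiberVal_act_one]

/-- The preimage of `Y` is a twisted product of `A` and `Y`, on which `n` acts on the second factor
through the cocycle `d a n`, the element of `M` over `w a * n * v (a · n)`. -/
theorem IsEtalePoint.essSurj_fiberFunctor (H : IsEtalePoint φ A a₀) :
    (fiberFunctor a₀ H.act_eq).EssSurj where
  mem_essImage Y := by
    choose v w hvw hv hw ha using H.exists_retraction
    have haw : ∀ a, A.act a₀ (w a) = a := fun a => act_retraction (hvw a) (ha a)
    have h1 : φ 1 * φ 1 = φ 1 := by rw [← map_mul, mul_one]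
    have hd : ∀ a n, ∃ m, φ m = w a * n * v (A.act a n) := fun a n =>
      H.exists_eq _ (by rw [← mul_assoc, ← mul_assoc, hw]) (by rw [mul_assoc, hv])
        (by rw [act_mul, act_mul, haw, ha])
    choose d hd using hd
    have hdd : ∀ a n n', d a n * d (A.act a n) n' = d a (n * n') := fun a n n' => H.injective (by
      rw [map_mul, hd, hd, hd, act_mul]
      simp only [mul_assoc]
      rw [← mul_assoc (v _) (w _), hvw, one_mul])
    -- The cocycle is not normalized: `d a 1` is only idempotent, and the action is unital only on
    -- the pairs fixed by it.
    let X : PSh N := of {z : A.Carrier × Y.Carrier // Y.act z.2 (d z.1 1) = z.2}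
      (fun z n => ⟨(A.act z.1.1 n, Y.act z.1.2 (d z.1.1 n)), by
        rw [← act_mul, hdd, mul_one]⟩)
      (fun z => Subtype.ext (Prod.ext (A.act_one _) z.2))
      (fun z n n' => Subtype.ext (Prod.ext (A.act_mul _ _ _) (by
        dsimp only
        rw [← act_mul, hdd])))
    let q : X ⟶ A := homOf (X := X) (fun z => z.1.1) fun _ _ => rfl
    -- With `t * s = 1` and `s * t = d a₀ (φ 1)`, acting by `s` and by `t` gives inverse bijections
    -- between the fiber over `a₀` and `Y`.
    obtain ⟨s, hs⟩ := H.exists_eq (w a₀ * φ 1) (by rw [← mul_assoc, hw])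
      (by rw [mul_assoc, h1]) (by rw [act_mul, haw, H.act_eq])
    obtain ⟨t, ht⟩ := H.exists_eq (φ 1 * v a₀) (by rw [← mul_assoc, h1])
      (by rw [mul_assoc, hv]) (by rw [act_mul, H.act_eq, ha])
    have hts : t * s = 1 := H.injective (by
      rw [map_mul, ht, hs, mul_assoc, ← mul_assoc (v a₀), hvw, one_mul, h1])
    have hst : ∀ m, s * m * t = d a₀ (φ m) := fun m => H.injective (by
      rw [map_mul, map_mul, ht, hs, hd, H.act_eq, mul_assoc (w a₀), ← map_mul, one_mul,
        mul_assoc, ← mul_assoc (φ m), ← map_mul, mul_one, mul_assoc])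
    have htd : t * d a₀ 1 = t := H.injective (by
      rw [map_mul, ht, hd, mul_one, A.act_one, mul_assoc, ← mul_assoc (v a₀), hvw, one_mul])
    let ι : X.Carrier → Y.Carrier := fun z => z.1.2
    have hι : ∀ z n, ι (X.act z n) = Y.act (ι z) (d (fn q z) n) := fun _ _ => rfl
    have X_ext : ∀ {z z'}, fn q z = fn q z' → ι z = ι z' → z = z' :=
      fun h h' => Subtype.ext (Prod.ext h h')
    let r : Y.Carrier → X.Carrier := fun y => ⟨(a₀, Y.act y t), by rw [← act_mul, htd]⟩
    have hr : ∀ y, ι (r y) = Y.act y t := fun _ => rfl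
    have hqr : ∀ y, fn q (r y) = a₀ := fun _ => rfl
    have hd1 : s * t = d a₀ (φ 1) := by rw [← hst, mul_one]
    have hfib : ∀ z : ((fiberFunctor a₀ H.act_eq).obj (Over.mk q)).Carrier,
        Y.act (ι (fiberVal z)) (s * t) = ι (fiberVal z) := fun z => by
      have h1 := hι (fiberVal z) (φ 1)
      have h2 : fn q (fiberVal z) = a₀ := fn_fiberVal z
      have h3 : X.act (fiberVal z) (φ 1) = fiberVal z := fiberVal_act_one z
      rwa [h3, h2, ← hd1, eq_comm] at h1
    refine ⟨Over.mk q, ⟨isoOf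
      { toFun := fun z => Y.act (ι (fiberVal z)) s
        invFun := fun y => fiberMk (X := Over.mk q) (r y) (X_ext ?_ ?_) (hqr y)
        left_inv := fun z => fiber_ext (X_ext (fn_fiberVal z).symm ?_)
        right_inv := fun y => ?_ } fun z m => ?_⟩⟩
    · exact (fn_act q _ _).trans (by rw [hqr, H.act_eq])
    · refine (hι _ _).trans ?_
      rw [hqr, hr, ← hd1, ← act_mul, ← mul_assoc, hts, one_mul]
    · refine (hr _).trans ?_
      rw [← act_mul, hfib]
    · change Y.act (ι (r y)) s = y
      rw [hr, ← act_mul, hts, act_one]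
    · have h1 := hι (fiberVal z) (φ m)
      have h2 : fn q (fiberVal z) = a₀ := fn_fiberVal z
      change Y.act (ι (X.act (fiberVal z) (φ m))) s = Y.act (Y.act (ι (fiberVal z)) s) m
      rw [h1, h2, ← hst, ← act_mul, ← act_mul, mul_assoc _ t, hts, mul_one]

theorem IsEtalePoint.isEquivalence_fiberFunctor (H : IsEtalePoint φ A a₀) :
    (fiberFunctor a₀ H.act_eq).IsEquivalence where
  faithful := H.faithful_fiberFunctor
  full := H.full_fiberFunctor
  essSurj := H.essSurj_fiberFunctor

theorem star_obj_hom (X : PSh N) : ((Over.star A).obj X).hom = (prod.fst : A ⨯ X ⟶ A) :=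
  prod.lift_fst prod.fst (𝟙 (A ⨯ X))

/-- The inverse image functor induced by `φ` is pullback to `A` followed by the fiber functor. -/
noncomputable def starCompFiberIso (h : ∀ m, A.act a₀ (φ m) = a₀) :
    Over.star A ⋙ fiberFunctor a₀ h ≅ inducedInverseImage φ :=
  NatIso.ofComponents (fun X => isoOf (Y := (inducedInverseImage φ).obj X)
    { toFun := fun z => ⟨fn (prod.snd : A ⨯ X ⟶ X) (fiberVal (h := h) z),
        (fn_act (prod.snd : A ⨯ X ⟶ X) _ _).symm.trans (congrArg _ (fiberVal_act_one (h := h) z))⟩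
      invFun := fun x => fiberMk (h := h) (X := (Over.star A).obj X) (pair a₀ x.1)
        ((pair_act _ _ _).trans (by rw [h, x.2]))
        ((congrArg (fun k => fn k _) (star_obj_hom X)).trans (fst_pair _ _))
      left_inv := fun z => fiber_ext (h := h) (prod_ext ((fst_pair _ _).trans ((fn_fiberVal (h := h) z).symm.trans
        (congrArg (fun k => fn k (fiberVal (h := h) z)) (star_obj_hom X)))) (snd_pair _ _))
      right_inv := fun x => Subtype.ext (snd_pair a₀ x.1) }
    fun z m => Subtype.ext (fn_act (prod.snd : A ⨯ X ⟶ X) (fiberVal (h := h) z) (φ m)))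
    fun {X Y} f => fn_ext fun z => Subtype.ext (by
      have : ((Over.star A).map f).left ≫ (prod.snd : A ⨯ Y ⟶ Y) = (prod.snd : A ⨯ X ⟶ X) ≫ f :=
        prod.map_snd (𝟙 A) f
      exact congrArg (fun k => fn k (fiberVal (h := h) z)) this)

theorem IsEtalePoint.isLocallyConstantEtale (H : IsEtalePoint φ A a₀) :
    (inducedMorphism φ).IsLocallyConstantEtale :=
  have := H.isEquivalence_fiberFunctor
  ⟨A, (fiberFunctor a₀ H.act_eq).asEquivalence.symm, (isLocallyConstantObject_iff A).2 H.bijective,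
    ⟨(starCompFiberIso H.act_eq).symm⟩⟩

end fiber

end PSh

namespace PSh

/-! ### When `e N e` and `N` have equivalent toposes -/

section corner

variable {N : Type u} [Monoid N] {e : N} (he : IsIdempotentElem e)

/-- The image of `n` under the retraction of `N` to `e N e`. -/
def toCorner (n : N) : he.Corner :=
  ⟨e * n * e, (Subsemigroup.mem_corner_iff he).2 ⟨by rw [← mul_assoc, ← mul_assoc, he], by
    rw [mul_assoc, he]⟩⟩

theorem val_toCorner (n : N) : (toCorner he n).1 = e * n * e := rfl

theorem corner_mul_val (x : he.Corner) : e * x.1 = x.1 := ((Subsemigroup.mem_corner_iff he).1 x.2).1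

theorem val_mul_corner (x : he.Corner) : x.1 * e = x.1 := ((Subsemigroup.mem_corner_iff he).1 x.2).2

theorem toCorner_val (x : he.Corner) : toCorner he x.1 = x :=
  Subtype.ext (by rw [val_toCorner, corner_mul_val, val_mul_corner])

theorem val_mul (x y : he.Corner) : (x * y).1 = x.1 * y.1 := rfl

theorem val_one : (1 : he.Corner).1 = e := rfl

/-- The right side says `N = NeN`. Faithfulness of `X ↦ Xe` already forces this; conversely it makes
the point of the terminal `N`-set étale, and the slice over that set is everything. -/
theorem isEquivalence_cornerInclusion_iff :
    (inducedMorphism (cornerInclusion he)).IsEquivalence ↔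
      ∃ v w : N, v * w = 1 ∧ v * e = v ∧ e * w = w := by
  constructor
  · intro h
    have hf : (inducedInverseImage (cornerInclusion he)).Faithful := h.faithful
    let Y : PSh N := of (Set N) (fun R n => {k | n * k ∈ R})
      (fun R => Set.ext fun k => by simp) fun R n n' => Set.ext fun k => by simp [mul_assoc]
    -- For the two-sided ideal `R = NeN`, the maps classifying `R` and `N` in the `N`-set of subsets
    -- agree on `Ne`, so faithfulness gives `R = N`.
    let R : Set N := {n | ∃ v w : N, v * e * w = n}
    have : elt (X := Y) R = elt (X := Y) Set.univ := hf.map_injective (fn_ext fun x =>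
      Subtype.ext (Set.ext fun k => by
        refine ⟨fun _ => trivial, fun _ => ⟨x.1, k, ?_⟩⟩
        exact congrArg (· * k) x.2))
    have h1 : (1 : N) ∈ R := by
      have := (fn_elt_unit (X := Y) R).symm.trans
        ((congrArg (fun f => fn f unit) this).trans (fn_elt_unit (X := Y) Set.univ))
      rw [this]
      trivial
    obtain ⟨v, w, hvw⟩ := h1
    refine ⟨v * e, e * w, ?_, by rw [mul_assoc, he], by rw [← mul_assoc, he]⟩
    rw [mul_assoc, ← mul_assoc e, he, ← mul_assoc, hvw]
  · rintro ⟨v, w, hvw, hv, hw⟩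
    let A : PSh N := of PUnit (fun x _ => x) (fun _ => rfl) fun _ _ _ => rfl
    have hA : IsTerminal A := IsTerminal.ofUniqueHom (fun X => homOf (fun _ => PUnit.unit)
      fun _ _ => rfl) fun X f => fn_ext fun _ => rfl
    have H : IsEtalePoint (cornerInclusion he) A PUnit.unit :=
      { bijective := fun n => Function.bijective_id
        injective := Subtype.val_injective
        act_eq := fun _ => rfl
        exists_eq := fun n h h' _ => ⟨⟨n, (Subsemigroup.mem_corner_iff he).2 ⟨h, h'⟩⟩, rfl⟩
        exists_retraction := fun _ => ⟨v, w, hvw, hv, hw, rfl⟩ }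
    have := H.isEquivalence_fiberFunctor
    have : (Over.forget A).IsEquivalence :=
      inferInstanceAs (Over.equivalenceOfIsTerminal hA).functor.IsEquivalence
    have : (Over.star A).IsEquivalence :=
      (Over.forgetAdjStar A).isEquivalence_right_of_isEquivalence_left
    exact Functor.isEquivalence_of_iso (starCompFiberIso H.act_eq)

end corner

/-! ### From an étale point to the conditions on `φ` -/

section conditions

variable {M N : Type u} [Monoid M] [Monoid N] {φ : M →ₙ* N}

theorem monoidHomPart_val (m : M) : (monoidHomPart φ m).1 = φ m := rfl

theorem IsEtalePoint.isBifactorableEmbedding {A : PSh N} {a₀ : A.Carrier}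
    (H : IsEtalePoint φ A a₀) : IsBifactorableEmbedding (monoidHomPart φ) := by
  have he := isIdempotentElem_map_one φ
  have hrange : ∀ x : he.Corner, x ∈ Set.range (monoidHomPart φ) ↔ A.act a₀ x.1 = a₀ := by
    intro x
    constructor
    · rintro ⟨m, rfl⟩
      exact H.act_eq m
    · intro h
      obtain ⟨m, hm⟩ := H.exists_eq x.1 (corner_mul_val he x) (val_mul_corner he x) h
      exact ⟨m, Subtype.ext hm⟩
  have hret : ∀ a, ∃ v w : N, v * φ 1 = v ∧ φ 1 * w = w ∧ A.act a v = a₀ ∧ A.act a₀ w = a ∧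
      toCorner he v * toCorner he w = 1 := fun a => by
    obtain ⟨v, w, hvw, hv, hw, ha⟩ := H.exists_retraction a
    refine ⟨v, w, hv, hw, ha, act_retraction hvw ha, Subtype.ext ?_⟩
    rw [val_mul, val_toCorner, val_toCorner, mul_assoc (φ 1) v, hv, hw, mul_assoc, ← mul_assoc v,
      hvw, one_mul, he]
    rfl
  have h1 : A.act a₀ (φ 1) = a₀ := H.act_eq 1
  refine ⟨fun m m' h => H.injective (congrArg Subtype.val h), fun x y hy hxy => ?_,
    fun x y hx hxy => ?_, fun n => ?_⟩
  · rw [hrange] at *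
    refine (H.bijective y.1).1 ?_
    change A.act (A.act a₀ x.1) y.1 = A.act a₀ y.1
    rw [← act_mul, ← val_mul, hxy, hy]
  · rw [hrange] at *
    rwa [val_mul, act_mul, hx] at hxy
  -- On the right, `v` carries `a₀ · n` back to `a₀`. On the left, `w'` carries `a₀` to the point
  -- `b` with `b · n = a₀`.
  · obtain ⟨v, w, hv, hw, ha, -, h⟩ := hret (A.act a₀ n.1)
    obtain ⟨b, hb⟩ := (H.bijective n.1).2 a₀
    obtain ⟨v', w', hv', hw', -, ha', h'⟩ := hret b
    refine ⟨toCorner he v, ⟨_, h⟩, toCorner he w', ⟨_, h'⟩, ?_, ?_⟩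
    · rw [hrange, val_mul, val_toCorner, ← mul_assoc, ← mul_assoc, val_mul_corner, mul_assoc, hv,
        act_mul, ha]
    · rw [hrange, val_mul, val_toCorner, hw', mul_assoc, corner_mul_val, act_mul, ha']
      exact hb

theorem IsEtalePoint.isEquivalence_cornerInclusion {A : PSh N} {a₀ : A.Carrier}
    (H : IsEtalePoint φ A a₀) :
    (inducedMorphism (cornerInclusion (isIdempotentElem_map_one φ))).IsEquivalence := by
  obtain ⟨v, w, hvw, hv, hw, -⟩ := H.exists_retraction a₀
  exact (isEquivalence_cornerInclusion_iff _).2 ⟨v, w, hvw, hv, hw⟩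

end conditions

end PSh

/-! ### The syntactic right congruence of `φ(M)` -/

section bifactorable

variable {N : Type u} [Monoid N]

/-- The elements `x` and `y` have the same right translates into `S`. -/
def SyntacticRel (S : Set N) (x y : N) : Prop := ∀ z, x * z ∈ S ↔ y * z ∈ S

variable {M : Type u} [Monoid M] {φ : M →* N}

theorem IsBifactorableEmbedding.mul_mem_iff (H : IsBifactorableEmbedding φ) {x : N}
    (hx : x ∈ Set.range φ) (y : N) : x * y ∈ Set.range φ ↔ y ∈ Set.range φ := by
  refine ⟨H.rightFactorable x y hx, ?_⟩
  obtain ⟨m, rfl⟩ := hx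
  rintro ⟨m', rfl⟩
  exact ⟨m * m', map_mul φ m m'⟩

/-- Take `c` with `c * t` in the image and `d * c = 1`. As `(x * d) * (c * t) = x * t`,
left-factorability puts `x * d` in the image, so `x * z = (x * d) * (c * z)` is there exactly when
`c * z` is, a condition independent of `x`. -/
theorem IsBifactorableEmbedding.syntacticRel_of_mul_mem (H : IsBifactorableEmbedding φ) {x y t : N}
    (hx : x * t ∈ Set.range φ) (hy : y * t ∈ Set.range φ) :
    SyntacticRel (Set.range φ) x y := by
  obtain ⟨-, -, c, ⟨d, hdc⟩, -, hc⟩ := H.exists_invertible t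
  have key : ∀ x : N, x * t ∈ Set.range φ → ∀ z, x * z ∈ Set.range φ ↔ c * z ∈ Set.range φ := by
    intro x hx z
    have hxd : x * d ∈ Set.range φ := H.leftFactorable _ (c * t) hc (by
      rwa [mul_assoc, ← mul_assoc d, hdc, one_mul])
    rw [← H.mul_mem_iff hxd (c * z), mul_assoc, ← mul_assoc d, hdc, one_mul]
  exact fun z => (key x hx z).trans (key y hy z).symm

/-- This gives injectivity of the action of `n` on classes: some `u` puts `x * n * u`, hence also `y
* n * u`, in the image. -/
theorem IsBifactorableEmbedding.syntacticRel_of_mul (H : IsBifactorableEmbedding φ) {x y n : N}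
    (h : SyntacticRel (Set.range φ) (x * n) (y * n)) : SyntacticRel (Set.range φ) x y := by
  obtain ⟨u, -, -, -, hu, -⟩ := H.exists_invertible (x * n)
  have hu' := (h u).1 hu
  rw [mul_assoc] at hu hu'
  exact H.syntacticRel_of_mul_mem hu hu'

/-- This gives surjectivity: choose `u` with `y * u` in the image, then `x` with `x * (n * u)` in
it. -/
theorem IsBifactorableEmbedding.exists_syntacticRel_mul (H : IsBifactorableEmbedding φ) (y n : N) :
    ∃ x, SyntacticRel (Set.range φ) (x * n) y := by
  obtain ⟨u, -, -, -, hu, -⟩ := H.exists_invertible y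
  obtain ⟨-, -, c, -, -, hc⟩ := H.exists_invertible (n * u)
  exact ⟨c, H.syntacticRel_of_mul_mem (t := u) (by rwa [mul_assoc]) hu⟩

end bifactorable

namespace PSh

/-! ### Construction of the étale point -/

section construction

variable {M N : Type u} [Monoid M] [Monoid N] {φ : M →ₙ* N}

theorem IsBifactorableEmbedding.exists_isEtalePoint
    (H : IsBifactorableEmbedding (monoidHomPart φ)) {v w : N} (hvw : v * w = 1)
    (hv : v * φ 1 = v) (hw : φ 1 * w = w) : ∃ A a₀, IsEtalePoint φ A a₀ := by
  have he := isIdempotentElem_map_one φ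
  let S : Set he.Corner := Set.range (monoidHomPart φ)
  let c : N → he.Corner := toCorner he
  have hc : ∀ n, (c n).1 = φ 1 * n * φ 1 := fun _ => rfl
  -- Inserting `v * w = 1`, which factors through `e`, makes the compression to `eNe` multiplicative
  -- enough to move the congruence on `N` into `eNe`.
  have hcv : ∀ x z, c (x * z) = c (x * v) * c (w * z) := fun x z => Subtype.ext (by
    rw [val_mul, hc, hc, hc, mul_assoc (φ 1) (x * v), mul_assoc x v, hv, ← mul_assoc (φ 1) w z, hw]
    simp only [mul_assoc]
    rw [← mul_assoc v w, hvw, one_mul])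
  have hleft : ∀ (x : he.Corner) z, c (x.1 * z) = x * c z := fun x z => Subtype.ext (by
    rw [val_mul, hc, hc, ← mul_assoc (φ 1) x.1, corner_mul_val, ← mul_assoc, ← mul_assoc,
      val_mul_corner])
  have hright : ∀ (x : he.Corner) z, c (z * x.1) = c z * x := fun x z => Subtype.ext (by
    rw [val_mul, hc, hc, mul_assoc _ (φ 1) x.1, corner_mul_val, mul_assoc, mul_assoc z,
      val_mul_corner, mul_assoc])
  have hmid : ∀ (x : he.Corner) y z, c (y * x.1 * z) = c y * x * c z := fun x y z =>
    Subtype.ext (by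
      rw [← hright, val_mul, hc, hc, hc]
      simp only [mul_assoc]
      rw [← mul_assoc x.1 (φ 1), val_mul_corner, ← mul_assoc x.1 (φ 1), val_mul_corner])
  let r : Setoid N :=
    { r := fun x y => ∀ z, c (x * z) ∈ S ↔ c (y * z) ∈ S
      iseqv := ⟨fun _ _ => Iff.rfl, fun h z => (h z).symm, fun h h' z => (h z).trans (h' z)⟩ }
  have hr : ∀ x y, r x y ↔ SyntacticRel S (c (x * v)) (c (y * v)) := by
    refine fun x y => ⟨fun h z => ?_, fun h z => ?_⟩
    · rw [← hright, ← hright, mul_assoc, mul_assoc]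
      exact h _
    · rw [hcv x, hcv y]
      exact h _
  have hn : ∀ x n, c (x * n * v) = c (x * v) * c (w * n * v) := fun x n => by
    rw [mul_assoc, hcv, mul_assoc]
  let A : PSh N := of (Quotient r)
    (fun a n => Quotient.map (· * n) (fun x y (h : ∀ z, _) z => by
      rw [mul_assoc, mul_assoc]
      exact h _) a)
    (by rintro ⟨x⟩; exact congrArg (Quotient.mk r) (mul_one x))
    (by rintro ⟨x⟩ n n'; exact congrArg (Quotient.mk r) (mul_assoc x n n').symm)
  let π : N → A.Carrier := Quotient.mk r
  have hπ : ∀ x n, A.act (π x) n = π (x * n) := fun _ _ => rfl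
  have hπr : ∀ x y, π x = π y ↔ ∀ z, c (x * z) ∈ S ↔ c (y * z) ∈ S := fun x y => Quotient.eq
  have hπs : ∀ x y, π x = π y ↔ SyntacticRel S (c (x * v)) (c (y * v)) := fun x y =>
    Quotient.eq.trans (hr x y)
  have hsurj : ∀ a, ∃ x, π x = a := Quotient.exists_rep
  have h1 : c 1 = 1 := Subtype.ext (by rw [hc, mul_one, he]; rfl)
  have hmul : ∀ s ∈ S, ∀ z, s * z ∈ S ↔ z ∈ S := fun s hs z => H.mul_mem_iff hs z
  refine ⟨A, π 1, fun n => ⟨fun a b h => ?_, fun b => ?_⟩, fun m m' h => ?_, fun m => ?_,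
    fun n h h' ha => ?_, fun a => ?_⟩
  · obtain ⟨x, rfl⟩ := hsurj a
    obtain ⟨y, rfl⟩ := hsurj b
    change A.act (π x) n = A.act (π y) n at h
    rw [hπ, hπ, hπs, hn x, hn y] at h
    exact (hπs _ _).2 (H.syntacticRel_of_mul h)
  · obtain ⟨y, rfl⟩ := hsurj b
    obtain ⟨x, hx⟩ := H.exists_syntacticRel_mul (c (y * v)) (c (w * n * v))
    refine ⟨π (x.1 * w), ?_⟩
    change A.act _ n = _
    rw [hπ, hπs, mul_assoc, mul_assoc, hleft, ← mul_assoc]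
    exact hx
  · exact H.injective (Subtype.ext h)
  · rw [hπ, hπr]
    intro z
    have : c (φ m * z) = monoidHomPart φ m * c z := hleft (monoidHomPart φ m) z
    rw [one_mul, one_mul, this]
    exact hmul _ ⟨m, rfl⟩ _
  · rw [hπ, hπr] at ha
    obtain ⟨m, hm⟩ := (ha 1).2 ⟨1, (map_one _).trans (h1.symm.trans (congrArg c (mul_one 1).symm))⟩
    refine ⟨m, ?_⟩
    rw [← monoidHomPart_val, hm, hc, one_mul, mul_one, h, h']
  · obtain ⟨x, rfl⟩ := hsurj a
    -- The retraction at the class of `x` is `v * u`, with right inverse `u' * w`: since `c (x * v)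
    -- * u` lies in `S`, `x * v * u` is congruent to `1`.
    obtain ⟨u, ⟨u', hu⟩, -, -, hxu, -⟩ := H.exists_invertible (c (x * v))
    refine ⟨v * u.1, u'.1 * w, ?_, ?_, ?_, ?_⟩
    · rw [mul_assoc, ← mul_assoc u.1, ← val_mul, hu, val_one, hw, hvw]
    · rw [mul_assoc, val_mul_corner]
    · rw [← mul_assoc, corner_mul_val]
    · rw [hπ, hπr]
      intro z
      have : c (x * (v * u.1) * z) = c (x * v) * u * c z := by
        rw [← mul_assoc, hmid]
      rw [this, one_mul]
      exact hmul _ hxu _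

theorem isLocallyConstantEtale_iff :
    (inducedMorphism φ).IsLocallyConstantEtale ↔ IsBifactorableEmbedding (monoidHomPart φ) ∧
      (inducedMorphism (cornerInclusion (isIdempotentElem_map_one φ))).IsEquivalence := by
  constructor
  · intro h
    obtain ⟨A, a₀, H⟩ := exists_isEtalePoint_of_isLocallyConstantEtale h
    exact ⟨H.isBifactorableEmbedding, H.isEquivalence_cornerInclusion⟩
  · rintro ⟨H, h⟩
    obtain ⟨v, w, hvw, hv, hw⟩ := (isEquivalence_cornerInclusion_iff _).1 h
    obtain ⟨A, a₀, H⟩ := IsBifactorableEmbedding.exists_isEtalePoint H hvw hv hw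
    exact H.isLocallyConstantEtale

/-- If `e = 1`, then `e N e` is all of `N`. -/
def cornerEquiv {e : N} (he : IsIdempotentElem e) (h1 : e = 1) : he.Corner ≃* N where
  toFun x := x.1
  invFun := toCorner he
  left_inv := toCorner_val he
  right_inv n := (val_toCorner he n).trans (by rw [h1, one_mul, mul_one])
  map_mul' _ _ := rfl

end construction

end PSh

/-! ### The case of a monoid homomorphism, where `e = 1` -/

theorem IsBifactorableEmbedding.equiv_comp {M N N' : Type u} [Monoid M] [Monoid N] [Monoid N']
    {φ : M →* N} (H : IsBifactorableEmbedding φ) (f : N ≃* N') :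
    IsBifactorableEmbedding (f.toMonoidHom.comp φ) := by
  have hr : ∀ y, y ∈ Set.range (f.toMonoidHom.comp φ) ↔ f.symm y ∈ Set.range φ := fun y =>
    exists_congr fun m => f.toEquiv.eq_symm_apply.symm
  refine ⟨f.injective.comp H.injective, fun x y hy hxy => ?_, fun x y hx hxy => ?_, fun n => ?_⟩
  · rw [hr] at *
    exact H.leftFactorable _ _ hy (by rwa [map_mul] at hxy)
  · rw [hr] at *
    exact H.rightFactorable _ _ hx (by rwa [map_mul] at hxy)
  · obtain ⟨u, ⟨u', hu⟩, v, ⟨v', hv⟩, hnu, hvn⟩ := H.exists_invertible (f.symm n)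
    refine ⟨f u, ⟨f u', by rw [← map_mul, hu, map_one]⟩, f v,
      ⟨f v', by rw [← map_mul, hv, map_one]⟩, ?_, ?_⟩
    · rwa [hr, map_mul, f.symm_apply_apply]
    · rwa [hr, map_mul, f.symm_apply_apply]

theorem isBifactorableEmbedding_monoidHomPart_iff {M N : Type u} [Monoid M] [Monoid N]
    (φ : M →* N) : IsBifactorableEmbedding (monoidHomPart (φ : M →ₙ* N)) ↔
      IsBifactorableEmbedding φ :=
  let f := PSh.cornerEquiv (isIdempotentElem_map_one (φ : M →ₙ* N)) (map_one φ)
  ⟨fun H => H.equiv_comp f, fun H => by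
    have := H.equiv_comp f.symm
    have h : f.symm.toMonoidHom.comp φ = monoidHomPart (φ : M →ₙ* N) :=
      MonoidHom.ext fun m => f.symm_apply_eq.2 rfl
    rwa [h] at this⟩

theorem mainTheorem10 {M N : Type u} [Monoid M] [Monoid N] :
    (∀ φ : M →* N,
      (PSh.inducedMorphism (φ : M →ₙ* N)).IsLocallyConstantEtale ↔
        IsBifactorableEmbedding φ) ∧
    (∀ φ : M →ₙ* N,
      (PSh.inducedMorphism φ).IsLocallyConstantEtale ↔
        IsBifactorableEmbedding (monoidHomPart φ) ∧
        (PSh.inducedMorphism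
          (cornerInclusion (isIdempotentElem_map_one φ))).IsEquivalence) := by
  refine ⟨fun φ => ?_, fun φ => PSh.isLocallyConstantEtale_iff⟩
  rw [PSh.isLocallyConstantEtale_iff, isBifactorableEmbedding_monoidHomPart_iff]
  refine and_iff_left ((PSh.isEquivalence_cornerInclusion_iff _).2 ⟨1, 1, mul_one 1, ?_, ?_⟩)
  · exact (one_mul _).trans (map_one φ)
  · exact (mul_one _).trans (map_one φ)
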